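/- Let $\mathcal X$ and $\hat{\mathcal X}$ be finite alphabets, let $X_1,X_2,\dots$ be an i.i.d. source with law $p_X$ on $\mathcal X$, let $d:\mathcal X\times\hat{\mathcal X}\to\mathbb R$ be a distortion measure and let $D\in\mathbb R$ be such that $\mathrm E[d(X,\hat X)]\le D$ for at least one conditional law $p_{\hat X|X}$, i.e. $D\ge D_{\min}:=\sum_x p_X(x)\min_{\hat x}d(x,\hat x)$. Logarithms are natural. A block code of length $N$ with $M$ codewords consists of an encoder $\mathcal X^N\to\{1,\dots,M\}$ and a decoder $\{1,\dots,M\}\to\hat{\mathcal X}^N$; its distortion is $\frac1N\sum_{n=1}^N\mathrm E[d(X_n,\hat X_n)]$, where $\hat X_1,\dots,\hat X_N$ is the decoded block. A rate $R$ is achievable at distortion $D$ if for every $\varepsilon>0$ and every sufficiently large $N$ there is a block code of length $N$ with at most $e^{NR}$ codewords and distortion at most $D+\varepsilon$. The rate-distortion function $R(D)$ is the infimum of the achievable rates. Put $$R'_1(D)=\min_{p_{\hat X|X}:\ \mathrm E[d(X,\hat X)]\le D} I(X;\hat X),\qquad L_1(\lambda,D)=\min_{p_{\hat X|X}}\Big[I(X;\hat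 X)+\lambda\big(\mathrm E[d(X,\hat X)]-D\big)\Big],\qquad R_1(D)=\sup_{\lambda\ge0}L_1(\lambda,D).$$ Then both minima are attained (for every $\lambda\ge 0$), the supremum is finite, and $$R(D)=R_1(D)=R'_1(D).$$ If $D>D_{\min}$, the supremum is attained, so that $$R(D)=\max_{\lambda\ge0}\ \min_{p_{\hat X|X}}\Big[I(X;\hat X)+\lambda\big(\mathrm E[d(X,\hat X)]-D\big)\Big].$$ Moreover, the following converse holds for every $N$. (i) Let $(X_n,\hat X_n)$, $1\le n\le N$, be pairs with $X_n\sim p_X$ and $\sum_{n=1}^N\mathrm E[d(X_n,\hat X_n)]\le ND$. Then $\sum_{n=1}^N I(X_n;\hat X_n)\ge N R_1(D)$, and for every $\lambda^*\ge0$ with $L_1(\lambda^*,D)=R_1(D)$, $$\sum_{n=1}^N I(X_n;\hat X_n)\ \ge\ \sum_{n=1}^N\Big(I(X_n;\hat X_n)+\lambda^*\big(\mathrm E[d(X_n,\hat X_n)]-D\big)\Big)\ \ge\ N R_1(D).$$ (ii) Every block code of length $N$ with $M$ codewords and distortion at most $D$ satisfies $\log M\ge N R_1(D)$. -/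

import Mathlib

namespace RateDistortion

/-- A conditional probability mass function `W x y = p(y | x)` between finite alphabets. -/
def IsTestChannel {α β : Type*} [Fintype β] (W : α → β → ℝ) : Prop :=
  ∀ x, W x ∈ stdSimplex ℝ β

/-- The law of the reproduction letter when the source letter has law `p` and is passed
through the test channel `W`. -/
noncomputable def outputLaw {α β : Type*} [Fintype α] (p : α → ℝ) (W : α → β → ℝ) (y : β) : ℝ :=
  ∑ x, p x * W x y

/-- The mutual information (in nats) of a pair with joint mass function `p x * W x y`.
Terms with `p x * W x y = 0` contribute `0`. -/
noncomputable def mutualInfo {α β : Type*} [Fintype α] [Fintype β]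
    (p : α → ℝ) (W : α → β → ℝ) : ℝ :=
  ∑ x, ∑ y, p x * W x y * Real.log (p x * W x y / (p x * outputLaw p W y))

/-- The expected distortion of a pair with joint mass function `p x * W x y`. -/
noncomputable def expectedDistortion {α β : Type*} [Fintype α] [Fintype β]
    (d : α → β → ℝ) (p : α → ℝ) (W : α → β → ℝ) : ℝ :=
  ∑ x, ∑ y, p x * W x y * d x y

/-- The objective `I + lam * (E d - D)` of the Lagrange dual function. -/
noncomputable def lagrangian {α β : Type*} [Fintype α] [Fintype β]
    (d : α → β → ℝ) (p : α → ℝ) (D lam : ℝ) (W : α → β → ℝ) : ℝ :=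
  mutualInfo p W + lam * (expectedDistortion d p W - D)

/-- The values of the Lagrangian over all test channels. -/
def lagrangianValues {α β : Type*} [Fintype α] [Fintype β]
    (d : α → β → ℝ) (p : α → ℝ) (D lam : ℝ) : Set ℝ :=
  {v | ∃ W : α → β → ℝ, IsTestChannel W ∧ v = lagrangian d p D lam W}

/-- The Lagrange dual function. -/
noncomputable def dualFunction {α β : Type*} [Fintype α] [Fintype β]
    (d : α → β → ℝ) (p : α → ℝ) (D lam : ℝ) : ℝ :=
  sInf (lagrangianValues d p D lam)

/-- The values of the Lagrange dual function over all nonnegative multipliers. -/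
def dualValues {α β : Type*} [Fintype α] [Fintype β]
    (d : α → β → ℝ) (p : α → ℝ) (D : ℝ) : Set ℝ :=
  {v | ∃ lam : ℝ, 0 ≤ lam ∧ v = dualFunction d p D lam}

/-- The Lagrangian expression for the rate-distortion function. -/
noncomputable def lagrangianRate {α β : Type*} [Fintype α] [Fintype β]
    (d : α → β → ℝ) (p : α → ℝ) (D : ℝ) : ℝ :=
  sSup (dualValues d p D)

/-- The mutual informations of the test channels with expected distortion at most `D`. -/
def primalValues {α β : Type*} [Fintype α] [Fintype β]
    (d : α → β → ℝ) (p : α → ℝ) (D : ℝ) : Set ℝ :=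
  {v | ∃ W : α → β → ℝ, IsTestChannel W ∧ expectedDistortion d p W ≤ D ∧ v = mutualInfo p W}

/-- The standard single-letter expression for the rate-distortion function. -/
noncomputable def primalRate {α β : Type*} [Fintype α] [Fintype β]
    (d : α → β → ℝ) (p : α → ℝ) (D : ℝ) : ℝ :=
  sInf (primalValues d p D)

/-- A code with `M` codewords for source blocks of length `N`. -/
structure BlockCode (α β : Type*) (N M : ℕ) where
  /-- the encoder -/
  encode : (Fin N → α) → Fin M
  /-- the decoder -/
  decode : Fin M → Fin N → β

/-- The expected per-letter distortion of a block code when the source letters are i.i.d. with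
law `p`. -/
noncomputable def BlockCode.distortion {α β : Type*} [Fintype α] {N M : ℕ}
    (c : BlockCode α β N M) (d : α → β → ℝ) (p : α → ℝ) : ℝ :=
  ∑ x : Fin N → α, (∏ i, p (x i)) * ((∑ i, d (x i) (c.decode (c.encode x) i)) / N)

/-- The rate `R` (in nats per source letter) is achievable at distortion level `D`: there are
codes of every large block length `N` with at most `exp (N * R)` codewords whose expected
distortion is asymptotically at most `D`. -/
def Achievable {α β : Type*} [Fintype α] (d : α → β → ℝ) (p : α → ℝ) (D R : ℝ) : Prop :=
  ∀ ε : ℝ, 0 < ε → ∀ᶠ N : ℕ in Filter.atTop,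
    ∃ (M : ℕ) (c : BlockCode α β N M), (M : ℝ) ≤ Real.exp (N * R) ∧ c.distortion d p ≤ D + ε

/-- The (operational) rate-distortion function: the infimum of the achievable rates. -/
noncomputable def rateDistortion {α β : Type*} [Fintype α]
    (d : α → β → ℝ) (p : α → ℝ) (D : ℝ) : ℝ :=
  sInf {R | Achievable d p D R}

end RateDistortion

/-!
The converse and the coding theorem are both reduced to the single-letter problem of minimizing
the mutual information `I(W)` over channels `W` with `E d ≤ D`.

*Duality.* Gibbs' inequality (`sum_informationDensity_le_mutualInfo`) writes `I` as a supremum of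
functions that are linear in the channel, so `I` is nonnegative and convex; it is also continuous
on the compact set of channels, which gives the minima. If some channel has distortion less than
`D`, convexity yields a supporting line at `D`, whose slope, negated, is an optimal multiplier
(`exists_primalRate_le_dualFunction`). If `D` is the smallest possible distortion, there need not
be such a multiplier, but minimizers of the Lagrangian for multipliers tending to infinity
accumulate at a feasible channel that is good enough
(`primalRate_le_lagrangianRate_of_forall_le`).

*Converse.* A block code induces a channel between the letters in each position
(`letterChannel`). Their mutual informations sum to at most `log M`: by `log t ≤ t - 1`, this
follows from the fact that the product of posteriors, for a fixed codeword, is a subprobability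
on source blocks (`sum_mutualInfo_letterChannel_le`). Each dual value is thus a lower bound for
the rate of a code, and it depends on `D` affinely, so that the slack `ε` in the definition of
achievability can be sent to `0` without a continuity property of the rate.

*Achievability.* Random codewords drawn from the output law of an optimal channel cover the source
(`exists_codebook`): the probability that none of them is jointly typical with the source block
is at most the probability that the channel output is atypical, which vanishes by Chebyshev's
inequality, plus a doubly exponentially small term.
-/

namespace RateDistortion

/-! ### Mutual information of a test channel -/

section Information

variable {α β : Type*} [Fintype α] [Fintype β] {p : α → ℝ} {W W' : α → β → ℝ}

theorem outputLaw_nonneg (hp : p ∈ stdSimplex ℝ α) (hW : IsTestChannel W) (y : β) :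
    0 ≤ outputLaw p W y :=
  Finset.sum_nonneg fun x _ => mul_nonneg (hp.1 x) ((hW x).1 y)

theorem mul_le_outputLaw (hp : p ∈ stdSimplex ℝ α) (hW : IsTestChannel W) (x : α) (y : β) :
    p x * W x y ≤ outputLaw p W y :=
  Finset.single_le_sum (f := fun x => p x * W x y)
    (fun x _ => mul_nonneg (hp.1 x) ((hW x).1 y)) (Finset.mem_univ x)

theorem outputLaw_pos (hp : p ∈ stdSimplex ℝ α) (hW : IsTestChannel W) {x : α} {y : β}
    (hx : 0 < p x) (hy : 0 < W x y) : 0 < outputLaw p W y :=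
  (mul_pos hx hy).trans_le (mul_le_outputLaw hp hW x y)

theorem sum_joint (hp : p ∈ stdSimplex ℝ α) (hW : IsTestChannel W) :
    ∑ x, ∑ y, p x * W x y = 1 := by
  simp_rw [← Finset.mul_sum, (hW _).2, mul_one, hp.2]

theorem outputLaw_mem_stdSimplex (hp : p ∈ stdSimplex ℝ α) (hW : IsTestChannel W) :
    outputLaw p W ∈ stdSimplex ℝ β := by
  refine ⟨outputLaw_nonneg hp hW, ?_⟩
  simp only [outputLaw]
  rw [Finset.sum_comm, sum_joint hp hW]

/-- Mutual information is `H(Y) - H(Y | X)`. This form is continuous in the channel. -/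
theorem mutualInfo_eq_entropy_sub (hp : p ∈ stdSimplex ℝ α) (hW : IsTestChannel W) :
    mutualInfo p W = ∑ y, Real.negMulLog (outputLaw p W y)
      - ∑ x, ∑ y, p x * Real.negMulLog (W x y) := by
  have h : ∀ x y, p x * W x y * Real.log (p x * W x y / (p x * outputLaw p W y)) =
      p x * W x y * (-Real.log (outputLaw p W y)) - p x * Real.negMulLog (W x y) := by
    intro x y
    rcases (hp.1 x).eq_or_lt with hx | hx
    · simp [← hx]
    rcases ((hW x).1 y).eq_or_lt with hy | hy
    · simp [← hy]
    rw [mul_div_mul_left _ _ hx.ne', Real.log_div hy.ne' (outputLaw_pos hp hW hx hy).ne',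
      Real.negMulLog]
    ring
  simp only [mutualInfo, h, Finset.sum_sub_distrib]
  congr 1
  rw [Finset.sum_comm]
  refine Finset.sum_congr rfl fun y _ => ?_
  rw [← Finset.sum_mul, Real.negMulLog]
  simp only [outputLaw]
  ring

theorem continuousOn_mutualInfo (hp : p ∈ stdSimplex ℝ α) :
    ContinuousOn (fun W : α → β → ℝ => mutualInfo p W) {W | IsTestChannel W} := by
  refine ContinuousOn.congr (Continuous.continuousOn ?_)
    fun W hW => mutualInfo_eq_entropy_sub hp hW
  simp only [outputLaw]
  have := Real.continuous_negMulLog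
  fun_prop

theorem continuous_expectedDistortion (d : α → β → ℝ) (p : α → ℝ) :
    Continuous fun W : α → β → ℝ => expectedDistortion d p W := by
  unfold expectedDistortion
  fun_prop

theorem isCompact_testChannels (α β : Type*) [Fintype α] [Fintype β] :
    IsCompact {W : α → β → ℝ | IsTestChannel W} := by
  convert isCompact_univ_pi fun _ : α => isCompact_stdSimplex ℝ β
  ext W
  simp [IsTestChannel]

/-- Gibbs' inequality: replacing the information density of `W` by that of another channel
`W'` whose support contains that of `W` can only decrease its mean. So mutual information is a
supremum of functions that are linear in the channel. -/
theorem sum_informationDensity_le_mutualInfo (hp : p ∈ stdSimplex ℝ α) (hW : IsTestChannel W)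
    (hW' : IsTestChannel W') (hs : ∀ x y, 0 < p x → 0 < W x y → 0 < W' x y) :
    ∑ x, ∑ y, p x * W x y * Real.log (p x * W' x y / (p x * outputLaw p W' y))
      ≤ mutualInfo p W := by
  have key : ∀ x y, p x * W x y - p x * W' x y * (outputLaw p W y / outputLaw p W' y) ≤
      p x * W x y * Real.log (p x * W x y / (p x * outputLaw p W y))
      - p x * W x y * Real.log (p x * W' x y / (p x * outputLaw p W' y)) := by
    intro x y
    rcases (hp.1 x).eq_or_lt with hx | hx
    · simp [← hx]
    rcases ((hW x).1 y).eq_or_lt with hy | hy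
    · have := mul_nonneg (mul_nonneg (hp.1 x) ((hW' x).1 y))
        (div_nonneg (outputLaw_nonneg hp hW y) (outputLaw_nonneg hp hW' y))
      simp only [← hy, mul_zero, zero_mul, sub_zero]
      linarith
    have hy' := hs x y hx hy
    have hq := outputLaw_pos hp hW hx hy
    have hq' := outputLaw_pos hp hW' hx hy'
    rw [mul_div_mul_left _ _ hx.ne', mul_div_mul_left _ _ hx.ne', ← mul_sub,
      ← Real.log_div (by positivity) (by positivity)]
    have := Real.one_sub_inv_le_log_of_pos
      (x := W x y / outputLaw p W y / (W' x y / outputLaw p W' y)) (by positivity)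
    refine le_trans (le_of_eq ?_) (mul_le_mul_of_nonneg_left this (mul_pos hx hy).le)
    field_simp
  have hsum : ∑ x, ∑ y, p x * W' x y * (outputLaw p W y / outputLaw p W' y) ≤ 1 := by
    rw [Finset.sum_comm, ← (outputLaw_mem_stdSimplex hp hW).2]
    refine Finset.sum_le_sum fun y _ => ?_
    rw [← Finset.sum_mul]
    change outputLaw p W' y * _ ≤ _
    rcases (outputLaw_nonneg hp hW' y).eq_or_lt with h | h
    · rw [← h, zero_mul]
      exact outputLaw_nonneg hp hW y
    · rw [mul_div_cancel₀ _ h.ne']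
  have := Finset.sum_le_sum fun x (_ : x ∈ Finset.univ) =>
    Finset.sum_le_sum fun y (_ : y ∈ Finset.univ) => key x y
  simp only [Finset.sum_sub_distrib, sum_joint hp hW] at this
  simp only [mutualInfo]
  linarith

theorem mutualInfo_nonneg (hp : p ∈ stdSimplex ℝ α) (hW : IsTestChannel W) :
    0 ≤ mutualInfo p W := by
  -- compare with the channel that ignores its input and has the same output law
  have hq : outputLaw p (fun _ => outputLaw p W) = outputLaw p W := by
    ext y
    rw [outputLaw, ← Finset.sum_mul, hp.2, one_mul]
  refine le_trans (le_of_eq ?_) (sum_informationDensity_le_mutualInfo hp hW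
    (W' := fun _ => outputLaw p W) (fun _ => outputLaw_mem_stdSimplex hp hW)
    fun x y hx hy => outputLaw_pos hp hW hx hy)
  rw [hq]
  refine (Finset.sum_eq_zero fun x _ => Finset.sum_eq_zero fun y _ => ?_).symm
  by_cases h : p x * outputLaw p W y = 0
  · simp [h]
  · simp [div_self h]

theorem IsTestChannel.combo {α β : Type*} [Fintype β] {W W' : α → β → ℝ}
    (hW : IsTestChannel W) (hW' : IsTestChannel W') {a b : ℝ}
    (ha : 0 ≤ a) (hb : 0 ≤ b) (hab : a + b = 1) : IsTestChannel (a • W + b • W') :=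
  fun x => convex_stdSimplex ℝ β (hW x) (hW' x) ha hb hab

theorem expectedDistortion_combo (d : α → β → ℝ) (p : α → ℝ) (W W' : α → β → ℝ) (a b : ℝ) :
    expectedDistortion d p (a • W + b • W')
      = a * expectedDistortion d p W + b * expectedDistortion d p W' := by
  simp only [expectedDistortion, Finset.mul_sum, ← Finset.sum_add_distrib]
  refine Finset.sum_congr rfl fun x _ => Finset.sum_congr rfl fun y _ => ?_
  simp only [Pi.add_apply, Pi.smul_apply, smul_eq_mul]
  ring

/-- Convexity of mutual information in the channel. -/
theorem mutualInfo_combo_le (hp : p ∈ stdSimplex ℝ α) (hW : IsTestChannel W)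
    (hW' : IsTestChannel W') {a b : ℝ} (ha : 0 < a) (hb : 0 < b) (hab : a + b = 1) :
    mutualInfo p (a • W + b • W') ≤ a * mutualInfo p W + b * mutualInfo p W' := by
  have hV := hW.combo hW' ha.le hb.le hab
  have h₁ := sum_informationDensity_le_mutualInfo hp hW hV fun x y _ hy => by
    have := (hW' x).1 y
    simp only [Pi.add_apply, Pi.smul_apply, smul_eq_mul]
    positivity
  have h₂ := sum_informationDensity_le_mutualInfo hp hW' hV fun x y _ hy => by
    have := (hW x).1 y
    simp only [Pi.add_apply, Pi.smul_apply, smul_eq_mul]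
    positivity
  refine le_trans (le_of_eq ?_) (add_le_add (mul_le_mul_of_nonneg_left h₁ ha.le)
    (mul_le_mul_of_nonneg_left h₂ hb.le))
  set V := a • W + b • W' with hVdef
  simp only [mutualInfo, Finset.mul_sum, ← Finset.sum_add_distrib]
  refine Finset.sum_congr rfl fun x _ => Finset.sum_congr rfl fun y _ => ?_
  have : V x y = a * W x y + b * W' x y := by simp [hVdef]
  generalize Real.log (p x * V x y / (p x * outputLaw p V y)) = l
  rw [this]
  ring

end Information

/-! ### Lagrangian duality -/

section Duality

variable {α β : Type*} [Fintype α] [Fintype β] {d : α → β → ℝ} {p : α → ℝ} {D : ℝ}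

theorem isLeast_dualFunction (hp : p ∈ stdSimplex ℝ α)
    (hne : ∃ W : α → β → ℝ, IsTestChannel W) (lam : ℝ) :
    IsLeast (lagrangianValues d p D lam) (dualFunction d p D lam) := by
  have hc : ContinuousOn (lagrangian d p D lam) {W | IsTestChannel W} :=
    (continuousOn_mutualInfo hp).add
      (((continuous_expectedDistortion d p).sub continuous_const).const_mul lam).continuousOn
  obtain ⟨W, hW, hmin⟩ := (isCompact_testChannels α β).exists_isMinOn hne hc
  have : IsLeast (lagrangianValues d p D lam) (lagrangian d p D lam W) :=
    ⟨⟨W, hW, rfl⟩, by rintro _ ⟨V, hV, rfl⟩; exact hmin hV⟩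
  rwa [dualFunction, this.csInf_eq]

theorem isLeast_primalRate (hp : p ∈ stdSimplex ℝ α)
    (hD : ∃ W : α → β → ℝ, IsTestChannel W ∧ expectedDistortion d p W ≤ D) :
    IsLeast (primalValues d p D) (primalRate d p D) := by
  have hK : IsCompact {W : α → β → ℝ | IsTestChannel W ∧ expectedDistortion d p W ≤ D} :=
    (isCompact_testChannels α β).inter_right
      (isClosed_le (continuous_expectedDistortion d p) continuous_const)
  obtain ⟨W, hW, hmin⟩ := hK.exists_isMinOn hD
    ((continuousOn_mutualInfo hp).mono fun W hW => hW.1)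
  have : IsLeast (primalValues d p D) (mutualInfo p W) :=
    ⟨⟨W, hW.1, hW.2, rfl⟩, by rintro _ ⟨V, hV, hV', rfl⟩; exact hmin ⟨hV, hV'⟩⟩
  rwa [primalRate, this.csInf_eq]

theorem dualFunction_le_lagrangian (hp : p ∈ stdSimplex ℝ α) (lam : ℝ) {W : α → β → ℝ}
    (hW : IsTestChannel W) : dualFunction d p D lam ≤ lagrangian d p D lam W :=
  (isLeast_dualFunction hp ⟨W, hW⟩ lam).2 ⟨W, hW, rfl⟩

/-- Weak duality. -/
theorem primalRate_mem_upperBounds (hp : p ∈ stdSimplex ℝ α)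
    (hD : ∃ W : α → β → ℝ, IsTestChannel W ∧ expectedDistortion d p W ≤ D) :
    primalRate d p D ∈ upperBounds (dualValues d p D) := by
  rintro _ ⟨lam, hlam, rfl⟩
  obtain ⟨W, hW, hWD, h⟩ := (isLeast_primalRate hp hD).1
  rw [h]
  refine (dualFunction_le_lagrangian hp lam hW).trans ?_
  have := mul_nonneg hlam (sub_nonneg.2 hWD)
  rw [lagrangian]
  linarith

/-- Strong duality with an attained supremum, when the distortion constraint can be satisfied
strictly. The multiplier is the largest `lam` for which the line of slope `-lam` through
`(D, primalRate d p D)` stays below all pairs (distortion, mutual information) with distortion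
less than `D`; by convexity that line also stays below the pairs with distortion greater than `D`. -/
theorem exists_primalRate_le_dualFunction (hp : p ∈ stdSimplex ℝ α)
    (hD : ∃ W : α → β → ℝ, IsTestChannel W ∧ expectedDistortion d p W < D) :
    ∃ lam : ℝ, 0 ≤ lam ∧ primalRate d p D ≤ dualFunction d p D lam := by
  obtain ⟨W₀, hW₀, hW₀D⟩ := hD
  have hleast := isLeast_primalRate hp ⟨W₀, hW₀, hW₀D.le⟩
  have hr : ∀ W : α → β → ℝ, IsTestChannel W → expectedDistortion d p W ≤ D →
      primalRate d p D ≤ mutualInfo p W := fun W hW h => hleast.2 ⟨W, hW, h, rfl⟩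
  set r := primalRate d p D
  let S : Set ℝ := {s | ∃ W : α → β → ℝ, IsTestChannel W ∧ expectedDistortion d p W < D ∧
    s = (mutualInfo p W - r) / (D - expectedDistortion d p W)}
  have hSne : S.Nonempty := ⟨_, W₀, hW₀, hW₀D, rfl⟩
  have hS0 : ∀ s ∈ S, 0 ≤ s := by
    rintro _ ⟨W, hW, h, rfl⟩
    exact div_nonneg (sub_nonneg.2 (hr W hW h.le)) (sub_pos.2 h).le
  refine ⟨sInf S, le_csInf hSne hS0, ?_⟩
  obtain ⟨W, hW, h⟩ := (isLeast_dualFunction (d := d) (D := D) hp ⟨W₀, hW₀⟩ (sInf S)).1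
  rw [h, lagrangian]
  rcases lt_trichotomy (expectedDistortion d p W) D with hlt | heq | hgt
  · have := csInf_le ⟨0, hS0⟩ (show _ ∈ S from ⟨W, hW, hlt, rfl⟩)
    rw [le_div_iff₀ (sub_pos.2 hlt)] at this
    linarith
  · rw [heq, sub_self, mul_zero, add_zero]
    exact hr W hW heq.le
  · have hpos := sub_pos.2 hgt
    have : (r - mutualInfo p W) / (expectedDistortion d p W - D) ≤ sInf S := by
      refine le_csInf hSne ?_
      rintro _ ⟨V, hV, hVD, rfl⟩
      have hVpos := sub_pos.2 hVD
      rw [div_le_div_iff₀ hpos hVpos]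
      -- mix `V` and `W` so that the distortion becomes exactly `D`
      set e := expectedDistortion d p W
      set e' := expectedDistortion d p V
      have hs : 0 < (e - D) + (D - e') := by linarith
      have hab : (e - D) / ((e - D) + (D - e')) + (D - e') / ((e - D) + (D - e')) = 1 := by
        field_simp
      have h₁ := mutualInfo_combo_le hp hV hW (div_pos hpos hs) (div_pos hVpos hs) hab
      have h₂ := hr _ (hV.combo hW (div_pos hpos hs).le (div_pos hVpos hs).le hab) (by
        rw [expectedDistortion_combo]
        change _ * e' + _ * e ≤ D
        apply le_of_eq
        field_simp
        ring)
      have h₃ := h₂.trans h₁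
      rw [div_mul_eq_mul_div, div_mul_eq_mul_div, ← add_div, le_div_iff₀ hs] at h₃
      linarith
    rw [div_le_iff₀ hpos] at this
    linarith

/-- Strong duality at the smallest distortion level: minimizers of the Lagrangian for
multipliers tending to infinity accumulate at a channel that is feasible, and whose mutual
information is at most the supremum of the dual function. -/
theorem primalRate_le_lagrangianRate_of_forall_le (hp : p ∈ stdSimplex ℝ α)
    (hD : ∃ W : α → β → ℝ, IsTestChannel W ∧ expectedDistortion d p W ≤ D)
    (hmin : ∀ W : α → β → ℝ, IsTestChannel W → D ≤ expectedDistortion d p W) :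
    primalRate d p D ≤ lagrangianRate d p D := by
  have hub := primalRate_mem_upperBounds hp hD
  have hne : ∃ W : α → β → ℝ, IsTestChannel W := hD.imp fun _ h => h.1
  choose V hV hVeq using fun n : ℕ =>
    (isLeast_dualFunction (d := d) (D := D) hp hne ((n : ℝ) + 1)).1
  have hmem : ∀ n : ℕ, dualFunction d p D ((n : ℝ) + 1) ∈ dualValues d p D :=
    fun n => ⟨_, by positivity, rfl⟩
  obtain ⟨W, hW, φ, hφ, hlim⟩ := (isCompact_testChannels α β).tendsto_subseq hV
  have hE : expectedDistortion d p W ≤ D := by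
    have h₁ := ((continuous_expectedDistortion d p).tendsto W).comp hlim
    have h₂ : Filter.Tendsto (fun n => D + primalRate d p D * (1 / ((φ n : ℝ) + 1)))
        Filter.atTop (nhds D) := by
      simpa using ((tendsto_one_div_add_atTop_nhds_zero_nat (𝕜 := ℝ)).comp
        hφ.tendsto_atTop).const_mul (primalRate d p D) |>.const_add D
    refine le_of_tendsto_of_tendsto' h₁ h₂ fun n => ?_
    have := hub (hmem (φ n))
    rw [hVeq, lagrangian] at this
    have h0 := mutualInfo_nonneg hp (hV (φ n))
    rw [mul_one_div, ← sub_le_iff_le_add', le_div_iff₀ (by positivity)]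
    simp only [Function.comp]
    linarith
  have hI : mutualInfo p W ≤ lagrangianRate d p D := by
    have h₁ := (continuousOn_mutualInfo hp W hW).tendsto.comp
      (tendsto_nhdsWithin_iff.2 ⟨hlim, Filter.Eventually.of_forall fun n => hV (φ n)⟩)
    refine le_of_tendsto' h₁ fun n => ?_
    have h₂ : _ ≤ lagrangianRate d p D := le_csSup ⟨_, hub⟩ (hmem (φ n))
    rw [hVeq, lagrangian] at h₂
    have := mul_nonneg (by positivity : (0 : ℝ) ≤ (φ n : ℝ) + 1)
      (sub_nonneg.2 (hmin _ (hV (φ n))))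
    simp only [Function.comp]
    linarith
  exact ((isLeast_primalRate hp hD).2 ⟨W, hW, hE, rfl⟩).trans hI

theorem isLUB_lagrangianRate (hp : p ∈ stdSimplex ℝ α)
    (hD : ∃ W : α → β → ℝ, IsTestChannel W ∧ expectedDistortion d p W ≤ D) :
    IsLUB (dualValues d p D) (lagrangianRate d p D) :=
  isLUB_csSup ⟨_, 0, le_rfl, rfl⟩ ⟨_, primalRate_mem_upperBounds hp hD⟩

/-- Strong duality. -/
theorem lagrangianRate_eq_primalRate (hp : p ∈ stdSimplex ℝ α)
    (hD : ∃ W : α → β → ℝ, IsTestChannel W ∧ expectedDistortion d p W ≤ D) :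
    lagrangianRate d p D = primalRate d p D := by
  have hlub := isLUB_lagrangianRate hp hD
  refine le_antisymm (hlub.2 (primalRate_mem_upperBounds hp hD)) ?_
  by_cases h : ∃ W : α → β → ℝ, IsTestChannel W ∧ expectedDistortion d p W < D
  · obtain ⟨lam, hlam, hle⟩ := exists_primalRate_le_dualFunction hp h
    exact hle.trans (hlub.1 ⟨lam, hlam, rfl⟩)
  · push Not at h
    exact primalRate_le_lagrangianRate_of_forall_le hp hD h

theorem isGreatest_lagrangianRate (hp : p ∈ stdSimplex ℝ α)
    (hD : ∃ W : α → β → ℝ, IsTestChannel W ∧ expectedDistortion d p W < D) :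
    IsGreatest (dualValues d p D) (lagrangianRate d p D) := by
  have hD' := hD.imp fun _ h => And.intro h.1 h.2.le
  have hlub := isLUB_lagrangianRate hp hD'
  obtain ⟨lam, hlam, hle⟩ := exists_primalRate_le_dualFunction hp hD
  refine ⟨⟨lam, hlam, le_antisymm ?_ (hlub.1 ⟨lam, hlam, rfl⟩)⟩, hlub.1⟩
  exact (lagrangianRate_eq_primalRate hp hD').trans_le hle

/-- The Lagrangian bound for a sequence of letter channels. -/
theorem nsmul_dualFunction_le_sum_lagrangian (hp : p ∈ stdSimplex ℝ α) (lam : ℝ) {N : ℕ}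
    {W : Fin N → α → β → ℝ} (hW : ∀ n, IsTestChannel (W n)) :
    N * dualFunction d p D lam ≤ ∑ n, lagrangian d p D lam (W n) := by
  have := Finset.sum_le_sum fun n (_ : n ∈ Finset.univ) =>
    dualFunction_le_lagrangian (d := d) (D := D) hp lam (hW n)
  simpa using this

theorem sum_lagrangian_le_sum_mutualInfo {lam : ℝ} (hlam : 0 ≤ lam) {N : ℕ}
    {W : Fin N → α → β → ℝ} (hWD : ∑ n, expectedDistortion d p (W n) ≤ N * D) :
    ∑ n, lagrangian d p D lam (W n) ≤ ∑ n, mutualInfo p (W n) := by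
  have := mul_nonneg hlam (sub_nonneg.2 hWD)
  simp only [lagrangian, Finset.sum_add_distrib, ← Finset.mul_sum, Finset.sum_sub_distrib]
  simp only [Finset.sum_const, Finset.card_univ, Fintype.card_fin, nsmul_eq_mul]
  linarith

theorem mul_lagrangianRate_le_sum_mutualInfo (hp : p ∈ stdSimplex ℝ α)
    (hD : ∃ W : α → β → ℝ, IsTestChannel W ∧ expectedDistortion d p W ≤ D) {N : ℕ}
    {W : Fin N → α → β → ℝ} (hW : ∀ n, IsTestChannel (W n))
    (hWD : ∑ n, expectedDistortion d p (W n) ≤ N * D) :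
    N * lagrangianRate d p D ≤ ∑ n, mutualInfo p (W n) := by
  rcases N.eq_zero_or_pos with rfl | hN
  · simp
  have hN' : (0 : ℝ) < N := by exact_mod_cast hN
  rw [mul_comm, ← le_div_iff₀ hN']
  refine (isLUB_lagrangianRate hp hD).2 ?_
  rintro _ ⟨lam, hlam, rfl⟩
  rw [le_div_iff₀ hN', mul_comm]
  exact (nsmul_dualFunction_le_sum_lagrangian hp lam hW).trans
    (sum_lagrangian_le_sum_mutualInfo hlam hWD)

end Duality

/-! ### Converse for block codes -/

section Converse

variable {α β : Type*} [Fintype α] [Fintype β] {d : α → β → ℝ} {p : α → ℝ} {N : ℕ}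

theorem sum_prod_eq_one {γ : Type*} [Fintype γ] {π : γ → ℝ} (hπ : π ∈ stdSimplex ℝ γ)
    (ι : Type*) [Fintype ι] [DecidableEq ι] : ∑ z : ι → γ, ∏ i, π (z i) = 1 := by
  rw [← Fintype.prod_sum (fun (_ : ι) a => π a)]
  simp [hπ.2]

open Classical in
/-- The channel from the `n`-th source letter to the `n`-th letter of `g X`, where `X` is a block
of `N` i.i.d. letters of law `p`. Conditioning on `X n = x` is encoded by putting the point mass
at `x` in place of the `n`-th factor of the product law, so that no division is needed when
`p x = 0`. -/
noncomputable def letterChannel (p : α → ℝ) (g : (Fin N → α) → Fin N → β) (n : Fin N)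
    (x : α) (y : β) : ℝ :=
  ∑ z : Fin N → α, (∏ i, if i = n then (if z i = x then 1 else 0) else p (z i)) *
    if g z n = y then 1 else 0

theorem isTestChannel_letterChannel (hp : p ∈ stdSimplex ℝ α)
    (g : (Fin N → α) → Fin N → β) (n : Fin N) : IsTestChannel (letterChannel p g n) := by
  classical
  intro x
  have h0 : ∀ z : Fin N → α, 0 ≤ ∏ i, if i = n then (if z i = x then (1 : ℝ) else 0)
      else p (z i) := fun z => Finset.prod_nonneg fun i _ => by
    split_ifs
    exacts [zero_le_one, le_rfl, hp.1 _]
  refine ⟨fun y => Finset.sum_nonneg fun z _ => mul_nonneg (h0 z) (by split_ifs <;> simp), ?_⟩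
  simp only [letterChannel]
  rw [Finset.sum_comm]
  simp only [← Finset.mul_sum, Finset.sum_ite_eq, Finset.mem_univ, if_true, mul_one]
  rw [← Fintype.prod_sum (fun (i : Fin N) a =>
    if i = n then (if a = x then (1 : ℝ) else 0) else p a)]
  refine Finset.prod_eq_one fun i _ => ?_
  split_ifs
  · simp
  · exact hp.2

/-- Under the joint law of the `n`-th source and reproduction letters, expectations are those of
the block. -/
theorem sum_letterChannel (p : α → ℝ) (g : (Fin N → α) → Fin N → β) (n : Fin N)
    (F : α → β → ℝ) :
    ∑ x, ∑ y, p x * letterChannel p g n x y * F x y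
      = ∑ z : Fin N → α, (∏ i, p (z i)) * F (z n) (g z n) := by
  classical
  have hprod : ∀ (x : α) (z : Fin N → α),
      p x * (∏ i, if i = n then (if z i = x then (1 : ℝ) else 0) else p (z i))
        = if z n = x then ∏ i, p (z i) else 0 := by
    intro x z
    rw [← Finset.mul_prod_erase _ _ (Finset.mem_univ n),
      ← Finset.mul_prod_erase _ (fun i => p (z i)) (Finset.mem_univ n), if_pos rfl,
      Finset.prod_congr rfl fun i hi => if_neg (Finset.ne_of_mem_erase hi)]
    split_ifs with h
    · rw [h, one_mul]
    · simp
  have : ∀ x y, p x * letterChannel p g n x y * F x y = ∑ z : Fin N → α,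
      (if z n = x then ∏ i, p (z i) else 0) * ((if g z n = y then 1 else 0) * F x y) := by
    intro x y
    rw [letterChannel, Finset.mul_sum, Finset.sum_mul]
    refine Finset.sum_congr rfl fun z _ => ?_
    rw [← hprod]
    ring
  simp_rw [this]
  rw [Finset.sum_congr rfl fun x _ => Finset.sum_comm, Finset.sum_comm]
  refine Finset.sum_congr rfl fun z _ => ?_
  simp

theorem letterChannel_pos {α β : Type*} [Fintype α] {p : α → ℝ} (hp : p ∈ stdSimplex ℝ α)
    (g : (Fin N → α) → Fin N → β) (n : Fin N) {z : Fin N → α} (hz : ∀ i, 0 < p (z i)) :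
    0 < letterChannel p g n (z n) (g z n) := by
  classical
  refine Finset.sum_pos' (fun w _ => mul_nonneg (Finset.prod_nonneg fun i _ => ?_) ?_)
    ⟨z, Finset.mem_univ z, mul_pos (Finset.prod_pos fun i _ => ?_) (by simp)⟩
  · split_ifs
    exacts [zero_le_one, le_rfl, hp.1 _]
  · split_ifs <;> simp
  · split_ifs with h h'
    exacts [zero_lt_one, (h' (h ▸ rfl)).elim, hz i]

/-- The letter informations of a code with `M` codewords sum to at most `log M`. Let `Z` be the
product of the ratios of posterior and prior probabilities of the source letters. Then
`∑ I = E log Z ≤ log M + E Z / M - 1`, and `E Z ≤ M`, because for each fixed codeword the product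
of the posteriors is a subprobability on source blocks. -/
theorem sum_mutualInfo_letterChannel_le {M : ℕ} (hp : p ∈ stdSimplex ℝ α)
    (c : BlockCode α β N M) :
    ∑ n, mutualInfo p (letterChannel p (fun x => c.decode (c.encode x)) n) ≤ Real.log M := by
  classical
  set g : (Fin N → α) → Fin N → β := fun x => c.decode (c.encode x) with hg
  have hW := isTestChannel_letterChannel hp g
  have hM : (0 : ℝ) < M := by
    obtain ⟨x⟩ : Nonempty α := by
      by_contra h
      rw [not_nonempty_iff] at h
      simpa using hp.2
    exact_mod_cast (c.encode fun _ => x).pos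
  let V : Fin N → α → β → ℝ := fun n x y =>
    p x * letterChannel p g n x y / outputLaw p (letterChannel p g n) y
  have hV0 : ∀ n x y, 0 ≤ V n x y := fun n x y =>
    div_nonneg (mul_nonneg (hp.1 x) ((hW n x).1 y)) (outputLaw_nonneg hp (hW n) y)
  have hV1 : ∀ n y, ∑ x, V n x y ≤ 1 := fun n y => by
    simp only [V, ← Finset.sum_div]
    exact div_self_le_one _
  have hsum : ∑ z : Fin N → α, ∏ n, V n (z n) (g z n) ≤ M :=
    calc ∑ z : Fin N → α, ∏ n, V n (z n) (g z n)
        ≤ ∑ z : Fin N → α, ∑ m, ∏ n, V n (z n) (c.decode m n) :=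
          Finset.sum_le_sum fun z _ => Finset.single_le_sum
            (f := fun m => ∏ n, V n (z n) (c.decode m n))
            (fun m _ => Finset.prod_nonneg fun n _ => hV0 _ _ _) (Finset.mem_univ (c.encode z))
      _ = ∑ m, ∏ n, ∑ x, V n x (c.decode m n) := by
          rw [Finset.sum_comm]
          exact Finset.sum_congr rfl fun m _ =>
            (Fintype.prod_sum fun n x => V n x (c.decode m n)).symm
      _ ≤ ∑ _m : Fin M, (1 : ℝ) := Finset.sum_le_sum fun m _ => Finset.prod_le_one
          (fun n _ => Finset.sum_nonneg fun x _ => hV0 _ _ _) fun n _ => hV1 _ _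
      _ = M := by simp
  have hpt : ∀ z : Fin N → α, (∏ i, p (z i)) * ∑ n, Real.log (p (z n) *
      letterChannel p g n (z n) (g z n) /
        (p (z n) * outputLaw p (letterChannel p g n) (g z n)))
      ≤ (∏ i, p (z i)) * (Real.log M - 1) + (∏ n, V n (z n) (g z n)) / M := by
    intro z
    by_cases hz : ∀ i, 0 < p (z i)
    · have hWz := fun n => letterChannel_pos hp g n hz
      have hqz := fun n => outputLaw_pos hp (hW n) (hz n) (hWz n)
      have hr : ∀ n, 0 < p (z n) * letterChannel p g n (z n) (g z n) /
        (p (z n) * outputLaw p (letterChannel p g n) (g z n)) := fun n =>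
          div_pos (mul_pos (hz n) (hWz n)) (mul_pos (hz n) (hqz n))
      have hpr := Finset.prod_pos fun n (_ : n ∈ Finset.univ) => hr n
      have hlog := Real.log_le_sub_one_of_pos (div_pos hpr hM)
      rw [Real.log_div hpr.ne' hM.ne', Real.log_prod fun n _ => (hr n).ne'] at hlog
      have hVr : ∏ n, V n (z n) (g z n) = (∏ i, p (z i)) * ∏ n, (p (z n) *
          letterChannel p g n (z n) (g z n) /
          (p (z n) * outputLaw p (letterChannel p g n) (g z n))) := by
        rw [← Finset.prod_mul_distrib]
        refine Finset.prod_congr rfl fun n _ => ?_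
        have := (hz n).ne'
        simp only [V]
        rw [mul_div_mul_left _ _ this, mul_div_assoc]
      rw [hVr, mul_div_assoc, ← mul_add]
      refine mul_le_mul_of_nonneg_left ?_ (Finset.prod_nonneg fun i _ => hp.1 _)
      linarith
    · push Not at hz
      obtain ⟨i, hi⟩ := hz
      have : ∏ i, p (z i) = 0 :=
        Finset.prod_eq_zero (Finset.mem_univ i) (le_antisymm hi (hp.1 _))
      rw [this, zero_mul, zero_mul, zero_add]
      exact div_nonneg (Finset.prod_nonneg fun n _ => hV0 _ _ _) hM.le
  calc ∑ n, mutualInfo p (letterChannel p g n)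
      = ∑ z : Fin N → α, (∏ i, p (z i)) * ∑ n, Real.log (p (z n) *
          letterChannel p g n (z n) (g z n) /
          (p (z n) * outputLaw p (letterChannel p g n) (g z n))) := by
        simp only [mutualInfo, Finset.mul_sum]
        exact (Finset.sum_congr rfl fun n _ => sum_letterChannel p g n fun x y =>
          Real.log (p x * letterChannel p g n x y /
            (p x * outputLaw p (letterChannel p g n) y))).trans Finset.sum_comm
    _ ≤ ∑ z : Fin N → α, ((∏ i, p (z i)) * (Real.log M - 1) + (∏ n, V n (z n) (g z n)) / M) :=
        Finset.sum_le_sum fun z _ => hpt z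
    _ = Real.log M - 1 + (∑ z : Fin N → α, ∏ n, V n (z n) (g z n)) / M := by
        rw [Finset.sum_add_distrib, ← Finset.sum_mul, sum_prod_eq_one hp, one_mul,
          Finset.sum_div]
    _ ≤ Real.log M := by
        have := (div_le_one hM).2 hsum
        linarith

theorem sum_expectedDistortion_letterChannel {M : ℕ} (d : α → β → ℝ) (p : α → ℝ)
    (c : BlockCode α β N M) :
    ∑ n, expectedDistortion d p (letterChannel p (fun x => c.decode (c.encode x)) n)
      = N * c.distortion d p := by
  rcases N.eq_zero_or_pos with rfl | hN
  · simp
  have hN' : (N : ℝ) ≠ 0 := by exact_mod_cast hN.ne'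
  simp only [expectedDistortion, sum_letterChannel, BlockCode.distortion, Finset.mul_sum]
  rw [Finset.sum_comm]
  refine Finset.sum_congr rfl fun z _ => ?_
  rw [← Finset.mul_sum]
  field_simp

theorem BlockCode.mul_dualFunction_le_log {M : ℕ} {D lam : ℝ} (hp : p ∈ stdSimplex ℝ α)
    (hlam : 0 ≤ lam) (c : BlockCode α β N M) (hc : c.distortion d p ≤ D) :
    N * dualFunction d p D lam ≤ Real.log M := by
  refine (nsmul_dualFunction_le_sum_lagrangian hp lam fun n =>
    isTestChannel_letterChannel hp (fun x => c.decode (c.encode x)) n).trans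
    ((sum_lagrangian_le_sum_mutualInfo hlam ?_).trans (sum_mutualInfo_letterChannel_le hp c))
  rw [sum_expectedDistortion_letterChannel]
  gcongr

theorem BlockCode.mul_lagrangianRate_le_log {M : ℕ} {D : ℝ} (hp : p ∈ stdSimplex ℝ α)
    (hD : ∃ W : α → β → ℝ, IsTestChannel W ∧ expectedDistortion d p W ≤ D)
    (c : BlockCode α β N M) (hc : c.distortion d p ≤ D) :
    N * lagrangianRate d p D ≤ Real.log M := by
  refine (mul_lagrangianRate_le_sum_mutualInfo hp hD (fun n =>
    isTestChannel_letterChannel hp (fun x => c.decode (c.encode x)) n) ?_).trans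
    (sum_mutualInfo_letterChannel_le hp c)
  rw [sum_expectedDistortion_letterChannel]
  gcongr

theorem dualFunction_le_add_mul (hp : p ∈ stdSimplex ℝ α)
    (hne : ∃ W : α → β → ℝ, IsTestChannel W) (D ε lam : ℝ) :
    dualFunction d p D lam ≤ dualFunction d p (D + ε) lam + lam * ε := by
  obtain ⟨W, hW, h⟩ := (isLeast_dualFunction (d := d) (D := D + ε) hp hne lam).1
  refine (dualFunction_le_lagrangian hp lam hW).trans_eq ?_
  rw [h, lagrangian, lagrangian]
  ring

theorem lagrangianRate_le_of_achievable {D R : ℝ} (hp : p ∈ stdSimplex ℝ α)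
    (hD : ∃ W : α → β → ℝ, IsTestChannel W ∧ expectedDistortion d p W ≤ D)
    (hR : Achievable d p D R) : lagrangianRate d p D ≤ R := by
  refine (isLUB_lagrangianRate hp hD).2 ?_
  rintro _ ⟨lam, hlam, rfl⟩
  refine le_of_forall_pos_le_add fun η hη => ?_
  have hε : 0 < η / (lam + 1) := by positivity
  obtain ⟨N, ⟨M, c, hM, hc⟩, hN⟩ := ((hR _ hε).and (Filter.eventually_gt_atTop 0)).exists
  have hN' : (0 : ℝ) < N := by exact_mod_cast hN
  have h₁ := c.mul_dualFunction_le_log hp hlam hc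
  have h₂ : Real.log M ≤ N * R := by
    rcases M.eq_zero_or_pos with rfl | hM0
    · obtain ⟨x⟩ : Nonempty α := by
        by_contra h
        rw [not_nonempty_iff] at h
        simpa using hp.2
      exact (c.encode fun _ => x).elim0
    · rw [← Real.log_exp (N * R)]
      exact Real.log_le_log (by exact_mod_cast hM0) hM
  have h₃ := le_of_mul_le_mul_left (h₁.trans h₂) hN'
  have h₄ := dualFunction_le_add_mul (d := d) hp (hD.imp fun _ h => h.1) D (η / (lam + 1)) lam
  have h₅ : lam * (η / (lam + 1)) ≤ η := by
    rw [mul_div_assoc', div_le_iff₀ (by positivity)]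
    nlinarith
  linarith

end Converse

/-! ### The weak law of large numbers for finite product laws -/

section WeakLaw

variable {γ : Type*} [Fintype γ] {π : γ → ℝ}

theorem sum_fin_cons (N : ℕ) (F : (Fin (N + 1) → γ) → ℝ) :
    ∑ z, F z = ∑ a, ∑ z : Fin N → γ, F (Fin.cons a z) := by
  rw [← Fintype.sum_prod_type', ← (Fin.consEquiv fun _ => γ).sum_comp]
  rfl

/-- The mean and the variance of a sum of i.i.d. centred variables. -/
theorem sum_prod_mul_sum_and_sq (hπ : π ∈ stdSimplex ℝ γ) {f : γ → ℝ}
    (hf : ∑ a, π a * f a = 0) (N : ℕ) :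
    ∑ z : Fin N → γ, (∏ i, π (z i)) * ∑ i, f (z i) = 0 ∧
    ∑ z : Fin N → γ, (∏ i, π (z i)) * (∑ i, f (z i)) ^ 2 = N * ∑ a, π a * f a ^ 2 := by
  induction N with
  | zero => simp
  | succ N ih =>
    obtain ⟨ih₁, ih₂⟩ := ih
    have h1 := sum_prod_eq_one hπ (Fin N)
    simp only [sum_fin_cons, Fin.prod_univ_succ, Fin.sum_univ_succ, Fin.cons_zero, Fin.cons_succ]
    constructor
    · calc _ = ∑ a, (π a * f a * ∑ z : Fin N → γ, ∏ i, π (z i)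
              + π a * ∑ z : Fin N → γ, (∏ i, π (z i)) * ∑ i, f (z i)) := by
            refine Finset.sum_congr rfl fun a _ => ?_
            rw [Finset.mul_sum, Finset.mul_sum, ← Finset.sum_add_distrib]
            exact Finset.sum_congr rfl fun z _ => by ring
        _ = 0 := by simp [h1, ih₁, hf]
    · calc _ = ∑ a, (π a * f a ^ 2 * ∑ z : Fin N → γ, ∏ i, π (z i)
              + 2 * (π a * f a) * ∑ z : Fin N → γ, (∏ i, π (z i)) * ∑ i, f (z i)
              + π a * ∑ z : Fin N → γ, (∏ i, π (z i)) * (∑ i, f (z i)) ^ 2) := by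
            refine Finset.sum_congr rfl fun a _ => ?_
            rw [Finset.mul_sum, Finset.mul_sum, Finset.mul_sum, ← Finset.sum_add_distrib,
              ← Finset.sum_add_distrib]
            exact Finset.sum_congr rfl fun z _ => by ring
        _ = _ := by
            rw [h1, ih₁, ih₂]
            simp only [mul_one, mul_zero, add_zero]
            rw [Finset.sum_add_distrib, ← Finset.sum_mul, hπ.2]
            push_cast
            ring

/-- The probability that the sum of `f` over `N` i.i.d. letters of law `π` exceeds its mean by
more than `N * δ`. -/
noncomputable def upperTail (π f : γ → ℝ) (δ : ℝ) (N : ℕ) : ℝ :=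
  ∑ z : Fin N → γ, if N * (∑ a, π a * f a + δ) < ∑ i, f (z i) then ∏ i, π (z i) else 0

/-- Chebyshev's inequality. -/
theorem upperTail_le (hπ : π ∈ stdSimplex ℝ γ) (f : γ → ℝ) {δ : ℝ} (hδ : 0 < δ) {N : ℕ}
    (hN : 0 < N) : upperTail π f δ N
      ≤ (∑ a, π a * (f a - ∑ b, π b * f b) ^ 2) / δ ^ 2 * (1 / N) := by
  have hN' : (0 : ℝ) < N := by exact_mod_cast hN
  set μ := ∑ b, π b * f b
  have h := (sum_prod_mul_sum_and_sq hπ (f := fun a => f a - μ) (by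
    simp [mul_sub, Finset.sum_sub_distrib, ← Finset.sum_mul, hπ.2, μ]) N).2
  have hle : upperTail π f δ N * (N * δ) ^ 2 ≤ N * ∑ a, π a * (f a - μ) ^ 2 := by
    rw [← h, upperTail, Finset.sum_mul]
    refine Finset.sum_le_sum fun z _ => ?_
    have h0 : 0 ≤ ∏ i, π (z i) := Finset.prod_nonneg fun i _ => hπ.1 _
    split_ifs with hz
    · refine mul_le_mul_of_nonneg_left (pow_le_pow_left₀ (by positivity) ?_ 2) h0
      rw [Finset.sum_sub_distrib]
      simp only [Finset.sum_const, Finset.card_univ, Fintype.card_fin, nsmul_eq_mul]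
      change N * (μ + δ) < _ at hz
      linarith
    · rw [zero_mul]
      positivity
  rw [← le_div_iff₀ (by positivity)] at hle
  refine hle.trans (le_of_eq ?_)
  field_simp

theorem tendsto_upperTail (hπ : π ∈ stdSimplex ℝ γ) (f : γ → ℝ) {δ : ℝ} (hδ : 0 < δ) :
    Filter.Tendsto (upperTail π f δ) Filter.atTop (nhds 0) := by
  have h := (tendsto_one_div_atTop_nhds_zero_nat (𝕜 := ℝ)).const_mul
    ((∑ a, π a * (f a - ∑ b, π b * f b) ^ 2) / δ ^ 2)
  rw [mul_zero] at h
  refine tendsto_of_tendsto_of_tendsto_of_le_of_le' tendsto_const_nhds h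
    (Filter.Eventually.of_forall fun N => Finset.sum_nonneg fun z _ => ?_)
    ((Filter.eventually_gt_atTop 0).mono fun N hN => upperTail_le hπ f hδ hN)
  split_ifs
  exacts [Finset.prod_nonneg fun i _ => hπ.1 _, le_rfl]

end WeakLaw

/-! ### Random coding -/

section RandomCoding

/-- The probability that none of `M` independent trials succeeds, if each succeeds with
probability at least `κ * u`. -/
theorem one_sub_pow_le {u s κ : ℝ} (hu0 : 0 ≤ u) (hu1 : u ≤ 1) (hs1 : s ≤ 1)
    (hs : κ * u ≤ s) (M : ℕ) : (1 - s) ^ M ≤ 1 - u + Real.exp (-(M * κ)) := by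
  have h₁ : (1 - s) ^ M ≤ Real.exp (-(κ * u)) ^ M := by
    refine pow_le_pow_left₀ (by linarith) ?_ M
    have := Real.add_one_le_exp (-(κ * u))
    linarith
  have h₂ := convexOn_exp.2 (Set.mem_univ 0) (Set.mem_univ (-(M * κ))) (sub_nonneg.2 hu1) hu0
    (sub_add_cancel 1 u)
  simp only [smul_eq_mul, mul_zero, zero_add, Real.exp_zero, mul_one] at h₂
  rw [← Real.exp_nat_mul, show M * -(κ * u) = u * -(M * κ) by ring] at h₁
  have h₃ := mul_le_of_le_one_left (Real.exp_pos (-(M * κ))).le hu1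
  linarith

open Classical in
/-- One-shot covering by a random codebook of `M` independent words of law `Q`. The encoder picks
a word that is jointly typical (`G`) with the source word whenever there is one. The hypothesis
`hκ` is a change of measure from the channel `V` to the codebook law `Q` on typical pairs. -/
theorem exists_codebook {X Y : Type*} [Fintype X] [Fintype Y] {P : X → ℝ} {Q : Y → ℝ}
    {V : X → Y → ℝ} (hP : P ∈ stdSimplex ℝ X) (hQ : Q ∈ stdSimplex ℝ Y) (hV : IsTestChannel V)
    (G : X → Y → Prop) {κ : ℝ} (hκ : ∀ x y, 0 < P x → G x y → κ * V x y ≤ Q y)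
    {dist : X → Y → ℝ} {A K : ℝ} (hK : 0 ≤ K) (hA : ∀ x y, G x y → dist x y ≤ A)
    (hAK : ∀ x y, dist x y ≤ A + K) {M : ℕ} (hM : 0 < M) :
    ∃ (c : Fin M → Y) (enc : X → Fin M), ∑ x, P x * dist x (c (enc x)) ≤
      A + K * (∑ x, ∑ y, (if G x y then 0 else P x * V x y) + Real.exp (-(M * κ))) := by
  have : Nonempty (Fin M → Y) := by
    have : Nonempty Y := by
      by_contra h
      rw [not_nonempty_iff] at h
      simpa using hQ.2
    infer_instance
  let enc : (Fin M → Y) → X → Fin M := fun c x =>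
    if h : ∃ m, G x (c m) then h.choose else ⟨0, hM⟩
  have henc : ∀ (c : Fin M → Y) (x : X),
      dist x (c (enc c x)) ≤ A + K * ∏ m, if G x (c m) then (0 : ℝ) else 1 := by
    intro c x
    by_cases h : ∃ m, G x (c m)
    · have h0 : (∏ m, if G x (c m) then (0 : ℝ) else 1) = 0 :=
        Finset.prod_eq_zero (Finset.mem_univ h.choose) (if_pos h.choose_spec)
      rw [h0, mul_zero, add_zero]
      refine hA _ _ ?_
      simp only [enc, dif_pos h]
      exact h.choose_spec
    · push Not at h
      simpa [h] using hAK x (c (enc c x))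
  have hmiss : ∀ x, P x * ∑ c : Fin M → Y, (∏ m, Q (c m)) *
      ∏ m, (if G x (c m) then (0 : ℝ) else 1)
      ≤ ∑ y, (if G x y then 0 else P x * V x y) + P x * Real.exp (-(M * κ)) := by
    intro x
    rcases (hP.1 x).eq_or_lt with hx | hx
    · simp [← hx]
    have hsplit : ∀ F : Y → ℝ, ∑ y, (if G x y then 0 else F y)
        = ∑ y, F y - ∑ y, (if G x y then F y else 0) := fun F => by
      rw [← Finset.sum_sub_distrib]
      exact Finset.sum_congr rfl fun y _ => by split_ifs <;> simp
    have hpow : ∑ c : Fin M → Y, (∏ m, Q (c m)) * ∏ m, (if G x (c m) then (0 : ℝ) else 1)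
        = (1 - ∑ y, (if G x y then Q y else 0)) ^ M := by
      simp_rw [← Finset.prod_mul_distrib, mul_ite, mul_zero, mul_one]
      rw [← Fintype.prod_sum fun (_ : Fin M) y => if G x y then 0 else Q y, hsplit, hQ.2]
      simp
    have hle1 : ∀ F ∈ stdSimplex ℝ Y, ∑ y, (if G x y then F y else 0) ≤ 1 := fun F hF => by
      rw [← hF.2]
      exact Finset.sum_le_sum fun y _ => by split_ifs; exacts [le_rfl, hF.1 y]
    have hone := one_sub_pow_le (κ := κ) (u := ∑ y, (if G x y then V x y else 0))
      (s := ∑ y, (if G x y then Q y else 0))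
      (Finset.sum_nonneg fun y _ => by split_ifs; exacts [(hV x).1 y, le_rfl])
      (hle1 _ (hV x)) (hle1 _ hQ)
      (by
        rw [Finset.mul_sum]
        refine Finset.sum_le_sum fun y _ => ?_
        split_ifs with h
        exacts [hκ x y hx h, by simp]) M
    rw [hpow, hsplit, ← Finset.mul_sum, (hV x).2]
    have hmul : ∑ y, (if G x y then P x * V x y else 0)
        = P x * ∑ y, (if G x y then V x y else 0) := by
      simp [Finset.mul_sum]
    rw [hmul, ← mul_sub, ← mul_add]
    exact mul_le_mul_of_nonneg_left hone hx.le
  -- the best codebook does at least as well as the average one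
  obtain ⟨c, hc⟩ := Finite.exists_min fun c : Fin M → Y => ∑ x, P x * dist x (c (enc c x))
  refine ⟨c, enc c, ?_⟩
  have hw0 : ∀ c : Fin M → Y, 0 ≤ ∏ m, Q (c m) := fun c => Finset.prod_nonneg fun m _ => hQ.1 _
  have hw1 := sum_prod_eq_one hQ (Fin M)
  calc ∑ x, P x * dist x (c (enc c x))
      = ∑ c' : Fin M → Y, (∏ m, Q (c' m)) * ∑ x, P x * dist x (c (enc c x)) := by
        rw [← Finset.sum_mul, hw1, one_mul]
    _ ≤ ∑ c' : Fin M → Y, (∏ m, Q (c' m)) * ∑ x, P x *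
          (A + K * ∏ m, if G x (c' m) then (0 : ℝ) else 1) :=
        Finset.sum_le_sum fun c' _ => mul_le_mul_of_nonneg_left ((hc c').trans
          (Finset.sum_le_sum fun x _ => mul_le_mul_of_nonneg_left (henc c' x) (hP.1 x))) (hw0 c')
    _ = ∑ c' : Fin M → Y, ((∏ m, Q (c' m)) * A + ∑ x, K * (P x * ((∏ m, Q (c' m)) *
          ∏ m, if G x (c' m) then (0 : ℝ) else 1))) := by
        refine Finset.sum_congr rfl fun c' _ => ?_
        simp only [mul_add, Finset.sum_add_distrib, ← Finset.sum_mul, hP.2, one_mul]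
        rw [Finset.mul_sum]
        exact congrArg _ (Finset.sum_congr rfl fun x _ => by ring)
    _ = A + K * ∑ x, P x * ∑ c' : Fin M → Y, (∏ m, Q (c' m)) *
          ∏ m, (if G x (c' m) then (0 : ℝ) else 1) := by
        rw [Finset.sum_add_distrib, ← Finset.sum_mul, hw1, one_mul, Finset.sum_comm]
        simp only [Finset.mul_sum]
    _ ≤ _ := by
        refine add_le_add le_rfl (mul_le_mul_of_nonneg_left ?_ hK)
        refine (Finset.sum_le_sum fun x _ => hmiss x).trans_eq ?_
        rw [Finset.sum_add_distrib, ← Finset.sum_mul, hP.2, one_mul]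

end RandomCoding

/-! ### Achievability -/

section Achievability

variable {α β : Type*} [Fintype α] [Fintype β] {d : α → β → ℝ} {p : α → ℝ} {W : α → β → ℝ}

theorem prod_mem_stdSimplex {γ : Type*} [Fintype γ] {π : γ → ℝ} (hπ : π ∈ stdSimplex ℝ γ)
    (N : ℕ) : (fun z : Fin N → γ => ∏ i, π (z i)) ∈ stdSimplex ℝ (Fin N → γ) :=
  ⟨fun _ => Finset.prod_nonneg fun _ _ => hπ.1 _, sum_prod_eq_one hπ _⟩

theorem joint_mem_stdSimplex (hp : p ∈ stdSimplex ℝ α) (hW : IsTestChannel W) :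
    (fun a : α × β => p a.1 * W a.1 a.2) ∈ stdSimplex ℝ (α × β) :=
  ⟨fun a => mul_nonneg (hp.1 _) ((hW _).1 _), by
    rw [Fintype.sum_prod_type]
    exact sum_joint hp hW⟩

theorem isTestChannel_prod {α β : Type*} [Fintype β] {W : α → β → ℝ}
    (hW : IsTestChannel W) (N : ℕ) :
    IsTestChannel fun (x : Fin N → α) (y : Fin N → β) => ∏ i, W (x i) (y i) := fun x =>
  ⟨fun _ => Finset.prod_nonneg fun _ _ => (hW _).1 _, by
    rw [← Fintype.prod_sum fun i b => W (x i) b]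
    exact Finset.prod_eq_one fun i _ => (hW (x i)).2⟩

/-- The upper tail of a function of i.i.d. pairs, as a sum over pairs of blocks. -/
theorem upperTail_joint (p : α → ℝ) (W f : α → β → ℝ) (δ : ℝ) (N : ℕ) :
    upperTail (fun a : α × β => p a.1 * W a.1 a.2) (fun a => f a.1 a.2) δ N
      = ∑ x : Fin N → α, ∑ y : Fin N → β,
        if N * (∑ a, ∑ b, p a * W a b * f a b + δ) < ∑ i, f (x i) (y i)
        then (∏ i, p (x i)) * ∏ i, W (x i) (y i) else 0 := by
  rw [upperTail, ← Fintype.sum_prod_type', Fintype.sum_prod_type]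
  refine Fintype.sum_equiv (Equiv.arrowProdEquivProdArrow _ _ _) _ _ fun z => ?_
  simp only [Equiv.arrowProdEquivProdArrow, Equiv.coe_fn_mk, Finset.prod_mul_distrib]
  rfl

/-- On blocks whose information density is at most `t`, the channel law is at most `exp t` times
the product of the output laws. -/
theorem exp_neg_mul_prod_le (hp : p ∈ stdSimplex ℝ α) (hW : IsTestChannel W) {N : ℕ} {t : ℝ}
    {x : Fin N → α} {y : Fin N → β} (hx : ∀ i, 0 < p (x i))
    (ht : ∑ i, Real.log (p (x i) * W (x i) (y i) / (p (x i) * outputLaw p W (y i))) ≤ t) :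
    Real.exp (-t) * ∏ i, W (x i) (y i) ≤ ∏ i, outputLaw p W (y i) := by
  by_cases hy : ∀ i, 0 < W (x i) (y i)
  · have hq := fun i => outputLaw_pos hp hW (hx i) (hy i)
    simp_rw [mul_div_mul_left _ _ (hx _).ne'] at ht
    rw [← Real.log_prod fun i _ => (div_pos (hy i) (hq i)).ne', Finset.prod_div_distrib,
      Real.log_le_iff_le_exp (div_pos (Finset.prod_pos fun i _ => hy i)
        (Finset.prod_pos fun i _ => hq i)),
      div_le_iff₀ (Finset.prod_pos fun i _ => hq i)] at ht
    rw [Real.exp_neg, inv_mul_le_iff₀ (Real.exp_pos t)]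
    exact ht
  · push Not at hy
    obtain ⟨i, hi⟩ := hy
    rw [Finset.prod_eq_zero (Finset.mem_univ i) (le_antisymm hi ((hW _).1 _)), mul_zero]
    exact Finset.prod_nonneg fun i _ => outputLaw_nonneg hp hW _

/-- Random codes with `M` words achieve distortion `D + δ` up to the probability of atypical
blocks and the probability that no codeword is jointly typical with the source block. -/
theorem exists_blockCode_distortion_le (hp : p ∈ stdSimplex ℝ α) (hW : IsTestChannel W) {D : ℝ}
    (hWD : expectedDistortion d p W ≤ D) {δ : ℝ} (hδ : 0 < δ) {N M : ℕ} (hN : 0 < N)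
    (hM : 0 < M) :
    ∃ c : BlockCode α β N M, c.distortion d p ≤ D + δ + (∑ x, ∑ y, |d x y| + |D|) *
      (upperTail (fun a : α × β => p a.1 * W a.1 a.2) (fun a => d a.1 a.2) δ N
        + upperTail (fun a : α × β => p a.1 * W a.1 a.2) (fun a => Real.log
            (p a.1 * W a.1 a.2 / (p a.1 * outputLaw p W a.2))) δ N
        + Real.exp (-(M * Real.exp (-(N * (mutualInfo p W + δ)))))) := by
  classical
  have hN' : (0 : ℝ) < N := by exact_mod_cast hN
  have hB : ∀ x y, d x y ≤ ∑ x, ∑ y, |d x y| := fun x y =>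
    (le_abs_self _).trans ((Finset.single_le_sum (f := fun y => |d x y|)
      (fun _ _ => abs_nonneg _) (Finset.mem_univ y)).trans
      (Finset.single_le_sum (f := fun x => ∑ y, |d x y|)
        (fun _ _ => Finset.sum_nonneg fun _ _ => abs_nonneg _) (Finset.mem_univ x)))
  set B := ∑ x, ∑ y, |d x y| with hBdef
  have hB0 : 0 ≤ B := Finset.sum_nonneg fun _ _ => Finset.sum_nonneg fun _ _ => abs_nonneg _
  let ι : α → β → ℝ := fun x y => Real.log (p x * W x y / (p x * outputLaw p W y))
  let G : (Fin N → α) → (Fin N → β) → Prop := fun x y =>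
    ∑ i, d (x i) (y i) ≤ N * (expectedDistortion d p W + δ) ∧
    ∑ i, ι (x i) (y i) ≤ N * (mutualInfo p W + δ)
  obtain ⟨c, enc, hc⟩ := exists_codebook (prod_mem_stdSimplex hp N)
    (prod_mem_stdSimplex (outputLaw_mem_stdSimplex hp hW) N) (isTestChannel_prod hW N) G
    (κ := Real.exp (-(N * (mutualInfo p W + δ))))
    (fun x y hx hG => exp_neg_mul_prod_le hp hW (fun i => (hp.1 _).lt_of_ne' fun h =>
      hx.ne' (Finset.prod_eq_zero (Finset.mem_univ i) h)) hG.2)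
    (dist := fun x y => (∑ i, d (x i) (y i)) / N) (A := D + δ) (K := B + |D|)
    (add_nonneg hB0 (abs_nonneg D))
    (fun x y hG => by
      rw [div_le_iff₀ hN', mul_comm]
      exact hG.1.trans (by gcongr))
    (fun x y => by
      have h := Finset.sum_le_sum fun i (_ : i ∈ Finset.univ) => hB (x i) (y i)
      simp only [Finset.sum_const, Finset.card_univ, Fintype.card_fin, nsmul_eq_mul] at h
      have h' : (∑ i, d (x i) (y i)) / N ≤ B := by
        rwa [div_le_iff₀ hN', mul_comm]
      have := neg_abs_le D
      linarith) hM
  refine ⟨⟨enc, c⟩, hc.trans ?_⟩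
  refine add_le_add le_rfl (mul_le_mul_of_nonneg_left (add_le_add ?_ le_rfl)
    (add_nonneg hB0 (abs_nonneg D)))
  rw [upperTail_joint p W d, upperTail_joint p W ι, ← Finset.sum_add_distrib]
  refine Finset.sum_le_sum fun x _ => ?_
  rw [← Finset.sum_add_distrib]
  refine Finset.sum_le_sum fun y _ => ?_
  have h0 : 0 ≤ (∏ i, p (x i)) * ∏ i, W (x i) (y i) :=
    mul_nonneg (Finset.prod_nonneg fun _ _ => hp.1 _)
      (Finset.prod_nonneg fun _ _ => (hW _).1 _)
  change _ ≤ (if N * (expectedDistortion d p W + δ) < _ then _ else _)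
    + (if N * (mutualInfo p W + δ) < _ then _ else _)
  by_cases hG : G x y
  · rw [if_pos hG]
    split_ifs <;> linarith
  · rw [if_neg hG]
    rcases not_and_or.1 hG with h | h
    · rw [if_pos (not_le.1 h)]
      split_ifs <;> linarith
    · rw [if_pos (not_le.1 h)]
      split_ifs <;> linarith

theorem achievable_of_mutualInfo_lt (hp : p ∈ stdSimplex ℝ α) (hW : IsTestChannel W) {D R : ℝ}
    (hWD : expectedDistortion d p W ≤ D) (hR : mutualInfo p W < R) : Achievable d p D R := by
  intro ε hε
  set I := mutualInfo p W
  have hI0 : 0 ≤ I := mutualInfo_nonneg hp hW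
  obtain ⟨δ, hδ, hδε, hδR⟩ : ∃ δ : ℝ, 0 < δ ∧ δ ≤ ε / 2 ∧ δ ≤ (R - I) / 2 :=
    ⟨min (ε / 2) ((R - I) / 2), lt_min (by linarith) (by linarith), min_le_left _ _,
      min_le_right _ _⟩
  have hπ := joint_mem_stdSimplex hp hW
  have hexp : Filter.Tendsto (fun N : ℕ => Real.exp (-((N : ℝ) * (δ / 2)))) Filter.atTop
      (nhds 0) :=
    Real.tendsto_exp_neg_atTop_nhds_zero.comp
      (tendsto_natCast_atTop_atTop.atTop_mul_const (by positivity))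
  have hlim := (((tendsto_upperTail hπ (fun a => d a.1 a.2) hδ).add (tendsto_upperTail hπ
    (fun a => Real.log (p a.1 * W a.1 a.2 / (p a.1 * outputLaw p W a.2))) hδ)).add hexp).const_mul
      (∑ x, ∑ y, |d x y| + |D|)
  simp only [add_zero, mul_zero] at hlim
  filter_upwards [hlim.eventually_le_const (half_pos hε), Filter.eventually_gt_atTop 0]
    with N hN hN0
  have hNR : 1 ≤ Real.exp (N * R) := Real.one_le_exp (by
    have : 0 ≤ R := hI0.trans hR.le
    positivity)
  have hM : 0 < ⌊Real.exp (N * R)⌋₊ := Nat.floor_pos.2 hNR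
  obtain ⟨c, hc⟩ := exists_blockCode_distortion_le hp hW hWD hδ hN0 hM
  refine ⟨_, c, Nat.floor_le (Real.exp_pos _).le, hc.trans ?_⟩
  have hMκ : N * (δ / 2) ≤ ⌊Real.exp (N * R)⌋₊ * Real.exp (-(N * (I + δ))) := by
    have h₁ : Real.exp (N * R) ≤ 2 * ⌊Real.exp (N * R)⌋₊ := by
      have := Nat.lt_floor_add_one (Real.exp (N * R))
      have : (1 : ℝ) ≤ ⌊Real.exp (N * R)⌋₊ := by exact_mod_cast hM
      linarith
    have h₂ : N * δ ≤ Real.exp (N * R) * Real.exp (-(N * (I + δ))) := by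
      rw [← Real.exp_add]
      have h₃ := Real.add_one_le_exp (N * R + -(N * (I + δ)))
      have h₄ : N * δ ≤ N * R + -(N * (I + δ)) := by
        have : (N : ℝ) * (2 * δ) ≤ N * (R - I) := by gcongr; linarith
        linarith
      linarith
    have h₅ := mul_le_mul_of_nonneg_right h₁ (Real.exp_pos (-(N * (I + δ)))).le
    linarith
  have hK : 0 ≤ ∑ x, ∑ y, |d x y| + |D| := by positivity
  have hmono := mul_le_mul_of_nonneg_left (add_le_add_right
    (Real.exp_le_exp.2 (neg_le_neg hMκ))
    (upperTail (fun a : α × β => p a.1 * W a.1 a.2) (fun a => d a.1 a.2) δ N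
        + upperTail (fun a : α × β => p a.1 * W a.1 a.2) (fun a => Real.log
            (p a.1 * W a.1 a.2 / (p a.1 * outputLaw p W a.2))) δ N)) hK
  linarith

theorem isGLB_rateDistortion {D : ℝ} (hp : p ∈ stdSimplex ℝ α)
    (hD : ∃ W : α → β → ℝ, IsTestChannel W ∧ expectedDistortion d p W ≤ D) :
    IsGLB {R | Achievable d p D R} (rateDistortion d p D) := by
  obtain ⟨W, hW, hWD⟩ := hD
  exact isGLB_csInf ⟨_, achievable_of_mutualInfo_lt hp hW hWD (lt_add_one _)⟩
    ⟨_, fun _ hR => lagrangianRate_le_of_achievable hp ⟨W, hW, hWD⟩ hR⟩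

theorem rateDistortion_eq_lagrangianRate {D : ℝ} (hp : p ∈ stdSimplex ℝ α)
    (hD : ∃ W : α → β → ℝ, IsTestChannel W ∧ expectedDistortion d p W ≤ D) :
    rateDistortion d p D = lagrangianRate d p D := by
  have hglb := isGLB_rateDistortion hp hD
  refine le_antisymm ?_ (hglb.2 fun R hR => lagrangianRate_le_of_achievable hp hD hR)
  rw [lagrangianRate_eq_primalRate hp hD]
  obtain ⟨W, hW, hWD, h⟩ := (isLeast_primalRate hp hD).1
  rw [h]
  exact le_of_forall_gt_imp_ge_of_dense fun R hR =>
    hglb.1 (achievable_of_mutualInfo_lt hp hW hWD hR)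

end Achievability

end RateDistortion

theorem mainTheorem4 {α β : Type*} [Fintype α] [Fintype β]
    (d : α → β → ℝ) (p : α → ℝ) (hp : p ∈ stdSimplex ℝ α) (D : ℝ)
    (hD : ∃ W : α → β → ℝ,
      RateDistortion.IsTestChannel W ∧ RateDistortion.expectedDistortion d p W ≤ D) :
    -- the infima, suprema and extrema below are genuine
    (∀ lam : ℝ, 0 ≤ lam → IsLeast (RateDistortion.lagrangianValues d p D lam)
      (RateDistortion.dualFunction d p D lam)) ∧
    IsLeast (RateDistortion.primalValues d p D) (RateDistortion.primalRate d p D) ∧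
    IsLUB (RateDistortion.dualValues d p D) (RateDistortion.lagrangianRate d p D) ∧
    ((∃ W : α → β → ℝ,
        RateDistortion.IsTestChannel W ∧ RateDistortion.expectedDistortion d p W < D) →
      IsGreatest (RateDistortion.dualValues d p D) (RateDistortion.lagrangianRate d p D)) ∧
    IsGLB {R | RateDistortion.Achievable d p D R} (RateDistortion.rateDistortion d p D) ∧
    -- the rate-distortion function, its Lagrangian form and its standard form agree
    RateDistortion.rateDistortion d p D = RateDistortion.lagrangianRate d p D ∧
    RateDistortion.lagrangianRate d p D = RateDistortion.primalRate d p D ∧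
    -- converse, for the per-letter test channels of a block
    (∀ (N : ℕ) (W : Fin N → α → β → ℝ), (∀ n, RateDistortion.IsTestChannel (W n)) →
      ∑ n, RateDistortion.expectedDistortion d p (W n) ≤ N * D →
      (N * RateDistortion.lagrangianRate d p D ≤ ∑ n, RateDistortion.mutualInfo p (W n)) ∧
      ∀ lam : ℝ, 0 ≤ lam →
        RateDistortion.dualFunction d p D lam = RateDistortion.lagrangianRate d p D →
        N * RateDistortion.lagrangianRate d p D
            ≤ ∑ n, RateDistortion.lagrangian d p D lam (W n) ∧
        ∑ n, RateDistortion.lagrangian d p D lam (W n)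
            ≤ ∑ n, RateDistortion.mutualInfo p (W n)) ∧
    -- converse, for block codes
    (∀ (N M : ℕ) (c : RateDistortion.BlockCode α β N M), c.distortion d p ≤ D →
      N * RateDistortion.lagrangianRate d p D ≤ Real.log M) :=
  ⟨fun lam _ => RateDistortion.isLeast_dualFunction hp (hD.imp fun _ h => h.1) lam,
    RateDistortion.isLeast_primalRate hp hD,
    RateDistortion.isLUB_lagrangianRate hp hD,
    RateDistortion.isGreatest_lagrangianRate hp,
    RateDistortion.isGLB_rateDistortion hp hD,
    RateDistortion.rateDistortion_eq_lagrangianRate hp hD,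
    RateDistortion.lagrangianRate_eq_primalRate hp hD,
    fun _ _ hW hWD => ⟨RateDistortion.mul_lagrangianRate_le_sum_mutualInfo hp hD hW hWD,
      fun lam hlam h => ⟨h ▸ RateDistortion.nsmul_dualFunction_le_sum_lagrangian hp lam hW,
        RateDistortion.sum_lagrangian_le_sum_mutualInfo hlam hWD⟩⟩,
    fun _ _ c hc => c.mul_lagrangianRate_le_log hp hD hc⟩
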